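/- For a real number $B \ge 2$ let $p_1 < p_2 < \dots < p_n$ be all the primes up to $B$, so $n = \pi(B)$. For positive weights $\alpha_1, \dots, \alpha_n$ put $$\gamma = \sqrt{\frac{n}{2\pi e}} \left[ \sqrt{\sum_{i=1}^n \left( \frac{\log p_i}{\alpha_i} \right)^2} \; \prod_{i=1}^n \alpha_i \right]^{1/n}.$$ With the choice $\alpha_i = \log p_i$ for all $i$, as $B \to \infty$ (equivalently, as $n = \pi(B) \to \infty$), $$\gamma \sim \sqrt{\frac{n}{2\pi e}} \, \bigl( \log n + \log\log n - 1 \bigr),$$ that is, the quotient of the two sides tends to $1$. Here $\log$ is the natural logarithm. -/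

import Mathlib

/-- The factor base `P_B = {p ≤ B}` of all primes up to the real smoothness bound `B`;
its cardinality is `n = π(B)`. -/
noncomputable def factorBase (B : ℝ) : Finset ℕ :=
  Nat.primesLE ⌊B⌋₊

theorem mem_factorBase {B : ℝ} {p : ℕ} : p ∈ factorBase B ↔ (p : ℝ) ≤ B ∧ p.Prime := by
  rw [factorBase, Nat.mem_primesLE]
  constructor
  · rintro ⟨h, hp⟩
    exact ⟨(Nat.le_floor_iff' hp.ne_zero).1 h, hp⟩
  · rintro ⟨h, hp⟩
    exact ⟨(Nat.le_floor_iff' hp.ne_zero).2 h, hp⟩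

theorem card_factorBase (B : ℝ) : (factorBase B).card = Nat.primeCounting ⌊B⌋₊ :=
  Nat.primesLE_card_eq_primeCounting _

/-- The normalising quantity
`γ = √(n / (2πe)) * [√(∑ (log pᵢ / αᵢ)²) * ∏ αᵢ]^(1/n)`, `n = #P`, of a factor base `P` with
weights; the weight `αᵢ` belonging to the prime `pᵢ ∈ P` is written `α pᵢ`. -/
noncomputable def latticeGamma (P : Finset ℕ) (α : ℕ → ℝ) : ℝ :=
  Real.sqrt ((P.card : ℝ) / (2 * Real.pi * Real.exp 1)) *
    (Real.sqrt (∑ p ∈ P, (Real.log (p : ℝ) / α p) ^ 2) * ∏ p ∈ P, α p) ^ ((1 : ℝ) / (P.card : ℝ))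

/-!
With `αᵢ = log pᵢ` every summand `(log pᵢ / αᵢ) ^ 2` equals `1`, so, up to the common factor
`√(n / (2πe))`, the quantity `γ` is `(√n) ^ (1 / n)`, which tends to `1`, times the geometric mean
of the `log p` over the primes `p ≤ N = ⌊B⌋`. Both this mean and `log n + log log n - 1` are
asymptotic to `log N`; Chebyshev's estimates suffice and the prime number theorem is not needed.

For the geometric mean, put `t = log p / log N ∈ (0, 1]`; the claim is that the mean of `-log t`
tends to `0` (`tendsto_sum_neg_log_div_primeCounting`). By `neg_log_le_mul_inv_sqrt`,
`-log t ≤ 2 (1 - t) / √t`, and `t ≥ log 2 / log N`, so the sum of the `-log t` is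
`O(√(log N))` times `∑ (1 - t) = π(N) - θ(N) / log N = O(N / log² N)`. Since `π(N) ≫ N / log N`,
the mean is `O(1 / √(log N))`.

For the other side, `N / (2 log N) ≤ π(N) ≤ N` gives `log n ∼ log N`, and `log log n - 1` is of
lower order.
-/

open Filter Topology Asymptotics Real

/-- A lower bound of Chebyshev type for the prime counting function. -/
theorem eventually_div_two_mul_log_le_primeCounting :
    ∀ᶠ N : ℕ in atTop, (N : ℝ) / (2 * log N) ≤ Nat.primeCounting N := by
  -- Since `log 2 > 0.69`, the term `log (N + 1)` in `Chebyshev.pi_ge` may cost up to `0.19 * N`.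
  have hlog : ∀ᶠ N : ℕ in atTop, log ((N : ℝ) + 1) ≤ (1 / 20 : ℝ) * ((N : ℝ) + 1) := by
    have h := isLittleO_log_id_atTop.def (show (0 : ℝ) < 1 / 20 by norm_num)
    have h2 := (tendsto_atTop_add_const_right atTop (1 : ℝ)
      (tendsto_natCast_atTop_atTop (R := ℝ))).eventually h
    filter_upwards [h2] with N hN
    simp only [id, norm_eq_abs] at hN
    rw [abs_of_nonneg (by positivity : (0 : ℝ) ≤ (N : ℝ) + 1)] at hN
    exact (le_abs_self _).trans hN
  filter_upwards [hlog, eventually_ge_atTop 2] with N hN hN2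
  have hN2' : (2 : ℝ) ≤ N := by exact_mod_cast hN2
  have hpos : 0 < log (N : ℝ) := log_pos (by linarith)
  refine le_trans ?_ (Chebyshev.pi_ge N)
  rw [div_le_div_iff₀ (by positivity) hpos]
  have := log_two_gt_d9
  have key : (N : ℝ) ≤ 2 * (N * log 2 - log (N + 1)) := by nlinarith
  nlinarith

theorem tendsto_log_primeCounting_div_log :
    Tendsto (fun N : ℕ => log (Nat.primeCounting N) / log N) atTop (𝓝 1) := by
  have hlogN : Tendsto (fun N : ℕ => log (N : ℝ)) atTop atTop :=
    tendsto_log_atTop.comp tendsto_natCast_atTop_atTop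
  have h0 : Tendsto (fun x : ℝ => log x / x) atTop (𝓝 0) :=
    isLittleO_log_id_atTop.tendsto_div_nhds_zero
  have hlow : Tendsto (fun N : ℕ => 1 - log 2 / log (N : ℝ) - log (log N) / log N) atTop (𝓝 1) := by
    have h1 : Tendsto (fun N : ℕ => log 2 / log (N : ℝ)) atTop (𝓝 0) :=
      hlogN.const_div_atTop _
    have h2 := h0.comp hlogN
    simpa using (h1.const_sub 1).sub h2
  refine tendsto_of_tendsto_of_tendsto_of_le_of_le' hlow tendsto_const_nhds ?_ ?_
  · filter_upwards [eventually_div_two_mul_log_le_primeCounting, eventually_ge_atTop 2]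
      with N hN hN2
    have hN2' : (2 : ℝ) ≤ N := by exact_mod_cast hN2
    have hpos : 0 < log (N : ℝ) := log_pos (by linarith)
    have h := log_le_log (by positivity) hN
    rw [log_div (by positivity) (by positivity), log_mul (by norm_num) hpos.ne'] at h
    rw [le_div_iff₀ hpos, sub_mul, sub_mul, div_mul_cancel₀ _ hpos.ne',
      div_mul_cancel₀ _ hpos.ne']
    linarith
  · filter_upwards [eventually_ge_atTop 2] with N hN2
    have hN2' : (2 : ℝ) ≤ N := by exact_mod_cast hN2
    have hpos : 0 < log (N : ℝ) := log_pos (by linarith)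
    rw [div_le_one hpos]
    have hle : Nat.primeCounting N ≤ N := by
      rw [← Nat.primesLE_card_eq_primeCounting]
      calc (Nat.primesLE N).card ≤ (Finset.Icc 1 N).card :=
            Finset.card_le_card fun p hp => by
              rw [Nat.mem_primesLE] at hp
              exact Finset.mem_Icc.2 ⟨hp.2.one_lt.le, hp.1⟩
        _ = N := by simp
    have hn : 0 < Nat.primeCounting N := by
      rw [Nat.pos_iff_ne_zero, Ne, Nat.primeCounting_eq_zero_iff]; omega
    exact log_le_log (by exact_mod_cast hn) (by exact_mod_cast hle)

/-- A bound for `-log t` that vanishes linearly at `t = 1` and is only of size `t ^ (-1 / 2)` near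
`0`, instead of the `t⁻¹` that `1 - t⁻¹ ≤ log t` gives. It is that inequality applied to `√t`. -/
theorem neg_log_le_mul_inv_sqrt {t : ℝ} (ht : 0 < t) (ht1 : t ≤ 1) :
    -log t ≤ 2 * (1 - t) / √t := by
  have hs : 0 < √t := sqrt_pos.2 ht
  have h := one_sub_inv_le_log_of_pos hs
  rw [log_sqrt ht.le] at h
  have hs1 : √t ≤ 1 := sqrt_le_one.2 ht1
  have hst : t ≤ √t := by nlinarith [sq_sqrt ht.le]
  have : (√t)⁻¹ - 1 ≤ (1 - t) / √t := by
    rw [le_div_iff₀ hs, sub_mul, inv_mul_cancel₀ hs.ne']; linarith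
  rw [mul_div_assoc]; linarith

/-- The primes up to `N` are, on average, so close to `N` on the `log log` scale that replacing each
`log p` by `log N` in the mean of `log log p` makes no difference in the limit. -/
theorem tendsto_sum_neg_log_div_primeCounting :
    Tendsto (fun N : ℕ => (∑ p ∈ Nat.primesLE N, -log (log p / log N)) / Nat.primeCounting N)
      atTop (𝓝 0) := by
  obtain ⟨C, hC⟩ := Chebyshev.primeCounting_sub_theta_div_log_isBigO.bound
  have hCN := (tendsto_natCast_atTop_atTop (R := ℝ)).eventually hC
  have hlogN : Tendsto (fun N : ℕ => log (N : ℝ)) atTop atTop :=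
    tendsto_log_atTop.comp tendsto_natCast_atTop_atTop
  have hup : Tendsto (fun N : ℕ => 4 * C / √(log 2) / √(log (N : ℝ))) atTop (𝓝 0) :=
    (tendsto_sqrt_atTop.comp hlogN).const_div_atTop _
  refine tendsto_of_tendsto_of_tendsto_of_le_of_le' tendsto_const_nhds hup ?_ ?_
  · filter_upwards [eventually_ge_atTop 2] with N hN2
    refine div_nonneg (Finset.sum_nonneg fun p hp => ?_) (Nat.cast_nonneg _)
    rw [Nat.mem_primesLE] at hp
    have hp2 : (2 : ℝ) ≤ p := by exact_mod_cast hp.2.two_le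
    have hpN : (p : ℝ) ≤ N := by exact_mod_cast hp.1
    have hl : 0 < log (p : ℝ) := log_pos (by linarith)
    have hlN := log_le_log (by linarith) hpN
    rw [neg_nonneg]
    exact log_nonpos (div_nonneg hl.le (hl.le.trans hlN)) ((div_le_one (hl.trans_le hlN)).2 hlN)
  · filter_upwards [hCN, eventually_div_two_mul_log_le_primeCounting, eventually_ge_atTop 2]
      with N hN hpi hN2
    have hN2' : (2 : ℝ) ≤ N := by exact_mod_cast hN2
    have hpos : 0 < log (N : ℝ) := log_pos (by linarith)
    have hl2 : 0 < log (2 : ℝ) := log_pos (by norm_num)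
    have hn : (0 : ℝ) < Nat.primeCounting N := lt_of_lt_of_le (by positivity) hpi
    -- The linear defect is exactly the difference that Chebyshev's estimates bound.
    have hsum : ∑ p ∈ Nat.primesLE N, (1 - log p / log N)
        = Nat.primeCounting N - Chebyshev.theta N / log N := by
      rw [Finset.sum_sub_distrib, ← Finset.sum_div, Chebyshev.theta_eq_sum_primesLE_log]
      simp [Nat.primesLE_card_eq_primeCounting]
    have hN' : (Nat.primeCounting N : ℝ) - Chebyshev.theta N / log N ≤ C * (N / log N ^ 2) := by
      have h := (le_abs_self _).trans hN
      simpa [abs_of_nonneg, hpos.le] using h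
    -- Each ratio is at least `log 2 / log N`, which bounds the square root in the denominator.
    have hterm : ∀ p ∈ Nat.primesLE N, -log (log p / log N)
        ≤ 2 * √(log N) / √(log 2) * (1 - log p / log N) := by
      intro p hp
      rw [Nat.mem_primesLE] at hp
      have hp2 : (2 : ℝ) ≤ p := by exact_mod_cast hp.2.two_le
      have hpN : (p : ℝ) ≤ N := by exact_mod_cast hp.1
      have hl : 0 < log (p : ℝ) := log_pos (by linarith)
      have hlN := log_le_log (by linarith) hpN
      have ht1 : log p / log N ≤ 1 := (div_le_one hpos).2 hlN
      refine (neg_log_le_mul_inv_sqrt (div_pos hl hpos) ht1).trans ?_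
      have hsq : √(log 2) / √(log N) ≤ √(log p / log N) := by
        rw [← sqrt_div hl2.le]
        exact sqrt_le_sqrt (by gcongr)
      calc 2 * (1 - log p / log N) / √(log p / log N)
          ≤ 2 * (1 - log p / log N) / (√(log 2) / √(log N)) := by
            have : 0 ≤ 1 - log p / log N := by linarith
            gcongr
        _ = _ := by field_simp
    have hC0 : 0 ≤ C * (N / log N ^ 2) := by
      refine le_trans ?_ hN'
      rw [← hsum]
      refine Finset.sum_nonneg fun p hp => ?_
      rw [Nat.mem_primesLE] at hp
      have hpN : (p : ℝ) ≤ N := by exact_mod_cast hp.1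
      have h0 : (0 : ℝ) < p := by exact_mod_cast hp.2.pos
      rw [sub_nonneg, div_le_one hpos]
      exact log_le_log h0 hpN
    rw [div_le_iff₀ hn]
    calc ∑ p ∈ Nat.primesLE N, -log (log p / log N)
        ≤ 2 * √(log N) / √(log 2) * ∑ p ∈ Nat.primesLE N, (1 - log p / log N) := by
          rw [Finset.mul_sum]; exact Finset.sum_le_sum hterm
      _ ≤ 2 * √(log N) / √(log 2) * (C * (N / log N ^ 2)) := by
          rw [hsum]; gcongr
      _ = 4 * C / √(log 2) / √(log (N : ℝ)) * (N / (2 * log N)) := by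
          have h := mul_self_sqrt hpos.le
          have hs : 0 < √(log (N : ℝ)) := sqrt_pos.2 hpos
          have hs2 : 0 < √(log (2 : ℝ)) := sqrt_pos.2 hl2
          generalize √(log (N : ℝ)) = s at *
          rw [← h]
          field_simp
          ring
      _ ≤ _ := by
          have hCn : 0 ≤ C := by
            by_contra hneg
            have : 0 < (N : ℝ) / log N ^ 2 := by positivity
            nlinarith
          gcongr

/-- The geometric mean of the `log p` over the primes `p ≤ N` is asymptotic to `log N`. -/
theorem tendsto_geomMean_log_primes_div_log :
    Tendsto (fun N : ℕ => (∏ p ∈ Nat.primesLE N, log (p : ℝ)) ^ ((1 : ℝ) / Nat.primeCounting N)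
      / log N) atTop (𝓝 1) := by
  have h := (continuous_exp.tendsto _).comp tendsto_sum_neg_log_div_primeCounting.neg
  rw [neg_zero, exp_zero] at h
  refine h.congr' ?_
  filter_upwards [eventually_ge_atTop 2] with N hN2
  have hN2' : (2 : ℝ) ≤ N := by exact_mod_cast hN2
  have hpos : 0 < log (N : ℝ) := log_pos (by linarith)
  have hn : Nat.primeCounting N ≠ 0 := by
    rw [Ne, Nat.primeCounting_eq_zero_iff]; omega
  have hl : ∀ p ∈ Nat.primesLE N, 0 < log (p : ℝ) := fun p hp =>
    log_pos (by exact_mod_cast (Nat.mem_primesLE.1 hp).2.one_lt)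
  have hP : 0 < ∏ p ∈ Nat.primesLE N, log (p : ℝ) := Finset.prod_pos hl
  have hn' : (Nat.primeCounting N : ℝ) ≠ 0 := by exact_mod_cast hn
  have hs : ∑ p ∈ Nat.primesLE N, -log (log p / log N)
      = Nat.primeCounting N * log (log N) - log (∏ p ∈ Nat.primesLE N, log (p : ℝ)) := by
    rw [log_prod fun p hp => (hl p hp).ne', Finset.sum_congr rfl fun p hp => by
      rw [log_div (hl p hp).ne' hpos.ne', neg_sub], Finset.sum_sub_distrib]
    simp [Nat.primesLE_card_eq_primeCounting]
  simp only [Function.comp]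
  rw [hs, rpow_def_of_pos hP]
  conv_rhs => enter [2]; rw [← exp_log hpos]
  rw [← exp_sub]
  congr 1
  field_simp
  ring

theorem tendsto_log_add_log_log_sub_one_div_log :
    Tendsto (fun N : ℕ => (log (Nat.primeCounting N) + log (log (Nat.primeCounting N)) - 1) / log N)
      atTop (𝓝 1) := by
  have hlogN : Tendsto (fun N : ℕ => log (N : ℝ)) atTop atTop :=
    tendsto_log_atTop.comp tendsto_natCast_atTop_atTop
  have hlogn : Tendsto (fun N : ℕ => log (Nat.primeCounting N : ℝ)) atTop atTop :=
    tendsto_log_atTop.comp (tendsto_natCast_atTop_atTop.comp Nat.tendsto_primeCounting)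
  have h0 : Tendsto (fun x : ℝ => log x / x) atTop (𝓝 0) :=
    isLittleO_log_id_atTop.tendsto_div_nhds_zero
  have h1 := tendsto_log_primeCounting_div_log
  have h2 := (h0.comp hlogn).mul h1
  have h3 : Tendsto (fun N : ℕ => 1 / log (N : ℝ)) atTop (𝓝 0) := hlogN.const_div_atTop _
  have h := (h1.add h2).sub h3
  simp only [zero_mul, add_zero, sub_zero] at h
  refine h.congr' ?_
  filter_upwards [hlogn.eventually_gt_atTop 0] with N hN
  simp only [Function.comp]
  field_simp

theorem tendsto_sqrt_rpow_one_div_primeCounting :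
    Tendsto (fun N : ℕ => √(Nat.primeCounting N : ℝ) ^ ((1 : ℝ) / Nat.primeCounting N))
      atTop (𝓝 1) := by
  have h : Tendsto (fun x : ℝ => √(x ^ (1 / x))) atTop (𝓝 1) := by
    simpa [Function.comp_def] using (continuous_sqrt.tendsto _).comp tendsto_rpow_div
  refine (h.comp (tendsto_natCast_atTop_atTop.comp Nat.tendsto_primeCounting)).congr fun N => ?_
  simp only [Function.comp]
  rw [sqrt_eq_rpow, sqrt_eq_rpow, ← rpow_mul (Nat.cast_nonneg _), ← rpow_mul (Nat.cast_nonneg _),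
    mul_comm]

/-- For the weights `log p`, every summand under the inner square root is `1`. -/
theorem latticeGamma_log {P : Finset ℕ} (hP : ∀ p ∈ P, p.Prime) :
    latticeGamma P (fun p => log (p : ℝ)) =
      √((P.card : ℝ) / (2 * π * exp 1)) *
        (√(P.card : ℝ) ^ ((1 : ℝ) / P.card) *
          (∏ p ∈ P, log (p : ℝ)) ^ ((1 : ℝ) / P.card)) := by
  have hl : ∀ p ∈ P, 0 < log (p : ℝ) := fun p hp =>
    log_pos (by exact_mod_cast (hP p hp).one_lt)
  rw [latticeGamma, Finset.sum_congr rfl fun p hp => by rw [div_self (hl p hp).ne', one_pow],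
    Finset.sum_const, nsmul_one,
    mul_rpow (sqrt_nonneg _) (Finset.prod_nonneg fun p hp => (hl p hp).le)]

theorem mainTheorem4 :
    Filter.Tendsto
      (fun B : ℝ =>
        latticeGamma (factorBase B) (fun p => Real.log (p : ℝ)) /
          (Real.sqrt ((Nat.primeCounting ⌊B⌋₊ : ℝ) / (2 * Real.pi * Real.exp 1)) *
            (Real.log (Nat.primeCounting ⌊B⌋₊ : ℝ) +
              Real.log (Real.log (Nat.primeCounting ⌊B⌋₊ : ℝ)) - 1)))
      Filter.atTop (nhds 1) := by
  have h := (tendsto_sqrt_rpow_one_div_primeCounting.mul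
    tendsto_geomMean_log_primes_div_log).div tendsto_log_add_log_log_sub_one_div_log one_ne_zero
  simp only [mul_one, div_one] at h
  refine (h.comp tendsto_nat_floor_atTop).congr' ?_
  filter_upwards [eventually_ge_atTop (2 : ℝ)] with B hB
  have hN2 : 2 ≤ ⌊B⌋₊ := Nat.le_floor hB
  have hlog : log (⌊B⌋₊ : ℝ) ≠ 0 := (log_pos (by exact_mod_cast hN2)).ne'
  have hn : (0 : ℝ) < Nat.primeCounting ⌊B⌋₊ := by
    rw [Nat.cast_pos, Nat.pos_iff_ne_zero, Ne, Nat.primeCounting_eq_zero_iff]; omega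
  have hs : √((Nat.primeCounting ⌊B⌋₊ : ℝ) / (2 * π * exp 1)) ≠ 0 :=
    (sqrt_pos.2 (by positivity)).ne'
  rw [latticeGamma_log fun p hp => (mem_factorBase.1 hp).2, card_factorBase,
    mul_div_mul_left _ _ hs, factorBase]
  simp only [Function.comp, Pi.div_apply]
  rw [← mul_div_assoc, div_div_div_cancel_right₀ hlog]
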